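/- **Setting.** Let $\mathcal S_0,\dots,\mathcal S_{T-1}$ be $k$-dimensional subspaces of a real Hilbert space $\mathcal H$, none contained in another, with bases $v_{i0},\dots,v_{i(k-1)}$. A signal is sampled by $M$ sampling vectors $a_0,\dots,a_{M-1}\in\mathcal H$, $(Ax)_m=\langle x,a_m\rangle$, where $A$ is one-to-one on $\bigcup_i\mathcal S_i$, and $\mathbf y=Ax+\mathbf w$ with $\mathbf w\sim\mathcal N(0,\sigma_w^2 I_M)$, $\sigma_w>0$. Put $\mathbf b_{im}=Av_{im}$, let $\mathbf B_i$ be the matrix with columns $\mathbf b_{im}$ and range $\mathcal R(\mathbf B_i)$, and let $\mathbf c_j\in\mathbb R^k$ be the (deterministic) coefficient vector of the signal when the true subspace is $\mathcal S_j$, so that then $Ax=\mathbf B_j\mathbf c_j$. For $i\ne j$ let $\mathcal W_{j\setminus i}=\{m:\mathbf b_{jm}\notin\mathcal R(\mathbf B_i)\}$ and $\mathbf B_{j\setminus i}\mathbf c_{j\setminus i}=\sum_{m\in\mathcal W_{j\setminus i}}c_j(m)\mathbf b_{jm}$. Let $$T_0(l)=\max_j\#\{i\neq j:|\mathcal W_{j\setminus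 i}|=l\},$$ $$\alpha_{\min,l}=\min\Big\{\tfrac1{\sigma_w}\big|\langle \mathbf q_{m,i},\mathbf B_{j\setminus i}\mathbf c_{j\setminus i}\rangle\big| : i\ne j,\ |\mathcal W_{j\setminus i}|=l,\ 1\le m\le M-k\Big\},$$ where $(\mathbf q_{m,i})_{m}$ is any fixed orthonormal basis of $\mathcal R(\mathbf B_i)^\perp$ (the eigenspace for the eigenvalue $1$ of the projector $\mathbf P_i^\perp$). Let $Q(x)=\frac1{\sqrt{2\pi}}\int_x^\infty e^{-t^2/2}dt$, $K_\nu(x)=\int_0^\infty e^{-x\cosh t}\cosh(\nu t)\,dt$, and $$\Psi(l,\lambda)=\frac{\sqrt2}{2^l\Gamma(l/2)}(\eta_0\lambda)^{l/2-1/2}K_{l/2-1/2}(\eta_0\lambda/2).$$ Let $P_e$ be the average probability of error of a maximum likelihood estimator of the index of the subspace, the true index being uniform on $\{0,\dots,T-1\}$, and let $$\bar P_e=\sum_{l=1}^kT_0(l)\Big[Q\big(\tfrac12(1-2\eta_0)\sqrt{(M-k)\alpha_{\min,l}^2}\big)+\Psi\big(l,(M-k)\alpha_{\min,l}^2\big)\Big].$$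 **Theorem.** Fix $k$, $0<\eta_0<\frac12$ and $r_0>0$, and put $b_0=\frac{\sqrt{2\pi}}4$. Consider a sequence of such problems (everything except $k,\eta_0,r_0$ may vary along it, including $\mathcal H$, $T$, $A$, the signals and $\sigma_w$) with $M-k\to\infty$ and, for each $l\in\{1,\dots,k\}$, $(M-k)\alpha_{\min,l}^2\to\infty$ along those members of the sequence for which $T_0(l)>0$. Suppose that $k\ge3$, or that the numbers $T_0(l)$ stay bounded along the sequence (for instance that the union is fixed). If (for all sufficiently late members) $$M>k+\max\{M_1,M_2\},$$ $$M_1=\max_l\frac{8}{(1-2\eta_0)^2\alpha_{\min,l}^2}\Big\{\log T_0(l)+\log\tfrac12\Big\},\qquad M_2=\max_l\frac{2(k/2+r_0-1)}{r_0\eta_0\alpha_{\min,l}^2}\Big\{\log T_0(l)+\log\frac{2b_0}{\sqrt\pi}\Big\},$$ the maxima being over the $l\in\{1,\dots,k\}$ with $T_0(l)>0$, then $\bar P_e\to0$, and also $P_e\to0$. -/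

import Mathlib

open MeasureTheory ProbabilityTheory Filter Topology

noncomputable section

namespace SubspaceRecovery

/-! ### Special functions -/

/-- The Gaussian `Q`-function. -/
def gaussianQ (x : ℝ) : ℝ :=
  1 / Real.sqrt (2 * Real.pi) * ∫ t in Set.Ioi x, Real.exp (-t ^ 2 / 2)

/-- The modified Bessel function `K_ν(x)` (for `x > 0`). -/
def besselK (ν x : ℝ) : ℝ :=
  ∫ t in Set.Ioi (0 : ℝ), Real.exp (-x * Real.cosh t) * Real.cosh (ν * t)

/-- The function `Ψ(l, lam)` with parameter `η₀`. -/
def Psi (η₀ : ℝ) (l : ℕ) (lam : ℝ) : ℝ :=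
  Real.sqrt 2 / (2 ^ l * Real.Gamma ((l : ℝ) / 2)) * (η₀ * lam) ^ ((l : ℝ) / 2 - 1 / 2) *
    besselK ((l : ℝ) / 2 - 1 / 2) (η₀ * lam / 2)

/-- The constant `b₀ = √(2π) / 4`. -/
def b₀ : ℝ := Real.sqrt (2 * Real.pi) / 4

/-! ### The union of subspaces and the sampling operator -/

section Model

variable {H : Type*} [NormedAddCommGroup H] [InnerProductSpace ℝ H]

/-- The sampling operator with sampling vectors `a`: `(A x)_m = ⟨x, a_m⟩`. -/
def sampling {M : ℕ} (a : Fin M → H) (x : H) : EuclideanSpace ℝ (Fin M) :=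
  WithLp.toLp 2 fun m => inner ℝ x (a m)

/-- The subspace `S_i` with basis `v i`. -/
def subspace {T k : ℕ} (v : Fin T → Fin k → H) (i : Fin T) : Submodule ℝ H :=
  Submodule.span ℝ (Set.range (v i))

end Model

/-- A noisy sampling problem for a union of `T` subspaces of dimension `k` with `M` samples. -/
structure Problem (H : Type*) [NormedAddCommGroup H] [InnerProductSpace ℝ H] (k T M : ℕ) where
  /-- the bases of the subspaces -/
  v : Fin T → Fin k → H
  linearIndependent_v : ∀ i, LinearIndependent ℝ (v i)
  /-- no subspace of the union lies in another one -/
  not_le : ∀ i j, i ≠ j → ¬ subspace v i ≤ subspace v j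
  /-- the sampling vectors -/
  a : Fin M → H
  /-- the sampling operator is one-to-one on the union -/
  injOn : Set.InjOn (sampling a) (⋃ i, (subspace v i : Set H))
  /-- `c j` is the coefficient vector of the (deterministic) signal if the true subspace is the
  `j`-th one -/
  c : Fin T → Fin k → ℝ
  /-- the standard deviation of the noise -/
  σ : ℝ
  σ_pos : 0 < σ

namespace Problem

variable {H : Type*} [NormedAddCommGroup H] [InnerProductSpace ℝ H] {k T M : ℕ}

/-- The `m`-th column `b_{im} = A v_{im}` of the matrix `B_i`. -/
def b (p : Problem H k T M) (i : Fin T) (m : Fin k) : EuclideanSpace ℝ (Fin M) :=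
  sampling p.a (p.v i m)

/-- The vector `B_i c = ∑_m c(m) b_{im}`. -/
def Bmul (p : Problem H k T M) (i : Fin T) (c : Fin k → ℝ) : EuclideanSpace ℝ (Fin M) :=
  ∑ m, c m • p.b i m

/-- The range `R(B_i)` of the matrix `B_i`. -/
def rangeB (p : Problem H k T M) (i : Fin T) : Submodule ℝ (EuclideanSpace ℝ (Fin M)) :=
  Submodule.span ℝ (Set.range (p.b i))

open Classical in
/-- The set `W_{j∖i}` of the indices of the columns of `B_j` that are not in `R(B_i)`. -/
def W (p : Problem H k T M) (j i : Fin T) : Finset (Fin k) :=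
  Finset.univ.filter fun m => p.b j m ∉ p.rangeB i

/-- The vector `B_{j∖i} c_{j∖i}`. -/
def Bdiff (p : Problem H k T M) (j i : Fin T) : EuclideanSpace ℝ (Fin M) :=
  ∑ m ∈ p.W j i, p.c j m • p.b j m

open Classical in
/-- The number `T_j(l)` of subspaces `S_i`, `i ≠ j`, such that `|W_{j∖i}| = l`. -/
def Tj (p : Problem H k T M) (j : Fin T) (l : ℕ) : ℕ :=
  (Finset.univ.filter fun i => i ≠ j ∧ (p.W j i).card = l).card

/-- `T₀(l) = max_j T_j(l)`. -/
def T₀ (p : Problem H k T M) (l : ℕ) : ℕ :=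
  Finset.univ.sup fun j => p.Tj j l

/-- For each `i`, an orthonormal eigenbasis `q_{m,i}` of the eigenspace of `P_i^⊥` for the
eigenvalue one, which is the orthogonal complement of `R(B_i)` and has dimension `M - k`. -/
abbrev Eigenbasis (p : Problem H k T M) : Type :=
  ∀ i : Fin T, OrthonormalBasis (Fin (M - k)) ℝ (p.rangeB i)ᗮ

/-- `α_{m,i} = ⟨q_{m,i}, B_{j∖i} c_{j∖i}⟩ / σ`, when the true subspace is `S_j`. -/
def α (p : Problem H k T M) (q : p.Eigenbasis) (j i : Fin T) (m : Fin (M - k)) : ℝ :=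
  1 / p.σ * inner ℝ (q i m : EuclideanSpace ℝ (Fin M)) (p.Bdiff j i)

/-- `α_{min,l}`: the minimum of `|α_{m,i}|` over all `m` and all pairs `i ≠ j` with
`|W_{j∖i}| = l`. -/
def αmin (p : Problem H k T M) (q : p.Eigenbasis) (l : ℕ) : ℝ :=
  sInf {t | ∃ j i m, i ≠ j ∧ (p.W j i).card = l ∧ t = |p.α q j i m|}

/-- The quantity `(M - k) α_{min,l}²`. -/
def snr (p : Problem H k T M) (q : p.Eigenbasis) (l : ℕ) : ℝ :=
  ((M : ℝ) - k) * p.αmin q l ^ 2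

/-- The upper bound on the probability of error,
`∑_{l=1}^k T₀(l) (Q((1 - 2 η₀) √((M-k) α_{min,l}²) / 2) + Ψ(l, (M-k) α_{min,l}²))`. -/
def errorBound (p : Problem H k T M) (q : p.Eigenbasis) (η₀ : ℝ) : ℝ :=
  ∑ l ∈ Finset.Icc 1 k, (p.T₀ l : ℝ) *
    (gaussianQ (1 / 2 * (1 - 2 * η₀) * Real.sqrt (p.snr q l)) + Psi η₀ l (p.snr q l))

/-- `f₁(l)`. -/
def f₁ (p : Problem H k T M) (q : p.Eigenbasis) (η₀ : ℝ) (l : ℕ) : ℝ :=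
  8 / ((1 - 2 * η₀) ^ 2 * p.αmin q l ^ 2) * (Real.log (p.T₀ l) + Real.log (1 / 2))

/-- `f₂(l)`. -/
def f₂ (p : Problem H k T M) (q : p.Eigenbasis) (η₀ r₀ : ℝ) (l : ℕ) : ℝ :=
  2 * ((k : ℝ) / 2 + r₀ - 1) / (r₀ * η₀ * p.αmin q l ^ 2) *
    (Real.log (p.T₀ l) + Real.log (2 * b₀ / Real.sqrt Real.pi))

/-- The levels `l ∈ {1, …, k}` that occur in the union. The other ones, for which `T₀(l) = 0`
and `log T₀(l) = -∞`, do not enter the maxima. -/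
def levels (p : Problem H k T M) : Set ℕ :=
  {l | 1 ≤ l ∧ l ≤ k ∧ 0 < p.T₀ l}

/-- `M₁ = max_l f₁(l)` (a maximum over a finite set). -/
def M₁ (p : Problem H k T M) (q : p.Eigenbasis) (η₀ : ℝ) : ℝ :=
  sSup (p.f₁ q η₀ '' p.levels)

/-- `M₂ = max_l f₂(l)` (a maximum over a finite set). -/
def M₂ (p : Problem H k T M) (q : p.Eigenbasis) (η₀ r₀ : ℝ) : ℝ :=
  sSup (p.f₂ q η₀ r₀ '' p.levels)

/-! ### Maximum likelihood subspace recovery -/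

/-- The density at `y` of the observation `B_i c + w`, where `w ∼ N(0, σ² I_M)`. -/
def likelihood (p : Problem H k T M) (i : Fin T) (c : Fin k → ℝ)
    (y : EuclideanSpace ℝ (Fin M)) : ℝ :=
  (2 * Real.pi * p.σ ^ 2) ^ (-((M : ℝ) / 2)) *
    Real.exp (-‖y - p.Bmul i c‖ ^ 2 / (2 * p.σ ^ 2))

/-- `ζ` is a maximum likelihood estimator of the index of the subspace (the coefficient vector
being unknown, the likelihood is maximized over it, too). -/
structure IsMLEstimator (p : Problem H k T M) (ζ : EuclideanSpace ℝ (Fin M) → Fin T) : Prop where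
  measurable : Measurable ζ
  isMax : ∀ y, ∃ c, ∀ i c', p.likelihood i c' y ≤ p.likelihood (ζ y) c y

/-- The law of the observation `y = A x + w`, `w ∼ N(0, σ² I_M)`, for the signal
`x = ∑_m c_j(m) v_{jm}` of `S_j`. -/
def law (p : Problem H k T M) (j : Fin T) : Measure (EuclideanSpace ℝ (Fin M)) :=
  multivariateGaussian (p.Bmul j (p.c j)) (p.σ ^ 2 • (1 : Matrix (Fin M) (Fin M) ℝ))

/-- The average probability of error of the estimator `ζ`, for a true subspace chosen uniformly
at random. -/
def errorProb (p : Problem H k T M) (ζ : EuclideanSpace ℝ (Fin M) → Fin T) : ℝ :=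
  ∑ j, (p.law j).real {y | ζ y ≠ j} * (1 / (T : ℝ))

end Problem

end SubspaceRecovery

end

noncomputable section

namespace SubspaceRecovery

/-! ### The Gaussian tail -/

/-! Maximum likelihood is minimum distance. If index `i` beats the true `j`, then the distance of
the observation to R(B_i) is at most its distance σ‖w‖ to the true point B_j c_j, with w standard
Gaussian. Put U = R(B_i) and let e be the component of B_{j∖i} c_{j∖i} orthogonal to U; then ‖e‖² +
2σ⟨e, w⟩ ≤ σ²‖P_U w‖². So either ⟨e, w⟩ is very negative, with probability Q((1 - 2η₀)‖e‖/(2σ)), or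
‖P_U w‖² ≥ 2η₀‖e‖²/σ², which a Chernoff bound in dimension at most k makes exponentially rare
(`law_eq_le_pairBound`). Parseval in the basis q gives ‖e‖² ≥ σ² (M - k) α_min². A union bound
grouped by levels finishes the estimate of P_e (`errorProb_le`), without passing through Ψ.

It remains to beat the factors T₀(l). The threshold M₁ gives T₀ ≤ 2 exp(x²/2), where x is the
argument of Q; since Q(x) ≤ exp(-x²/2)/x, the product is at most 2/x. The threshold M₂ gives T₀ ≤ C
exp(b λ) with λ = (M - k) α_min², and b < η₀/2 exactly because k ≥ 3; for bounded T₀, b = 0 works.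
Both Ψ (rate η₀/2 up to powers) and the Chernoff term (rate 3η₀/4) decay faster. -/

lemma integrable_exp_neg_sq_div_two : Integrable fun t : ℝ => Real.exp (-t ^ 2 / 2) := by
  convert integrable_exp_neg_mul_sq (b := 1 / 2) (by norm_num) using 3
  ring

lemma gaussianQ_nonneg (x : ℝ) : 0 ≤ gaussianQ x :=
  mul_nonneg (by positivity) (integral_nonneg fun _ => (Real.exp_pos _).le)

lemma gaussianQ_antitone : Antitone gaussianQ := fun x y hxy => by
  unfold gaussianQ
  gcongr
  · exact Eventually.of_forall fun _ => (Real.exp_pos _).le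
  · exact integrable_exp_neg_sq_div_two.integrableOn

lemma gaussianReal_Ici (x : ℝ) : (gaussianReal 0 1).real (Set.Ici x) = gaussianQ x := by
  rw [Measure.real, gaussianReal_apply_eq_integral _ one_ne_zero, ENNReal.toReal_ofReal
    (integral_nonneg fun _ => gaussianPDFReal_nonneg _ _ _), integral_Ici_eq_integral_Ioi]
  simp only [gaussianPDFReal, integral_const_mul, gaussianQ]
  simp

lemma hasDerivAt_neg_exp_neg_sq_div_two (t : ℝ) :
    HasDerivAt (fun t : ℝ => -Real.exp (-t ^ 2 / 2)) (t * Real.exp (-t ^ 2 / 2)) t := by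
  have h : HasDerivAt (fun t : ℝ => -t ^ 2 / 2) (-(2 * t) / 2) t := by
    simpa using (hasDerivAt_pow 2 t).fun_neg.div_const 2
  refine h.exp.fun_neg.congr_deriv ?_
  ring

/-- On (x, ∞) one has 1 ≤ t/x, and t exp(-t²/2) has an explicit primitive. The factor 1/x is
essential: M₁ leaves no slack in the exponent. -/
lemma gaussianQ_le {x : ℝ} (hx : 0 < x) : gaussianQ x ≤ Real.exp (-x ^ 2 / 2) / x := by
  have hlim : Tendsto (fun t : ℝ => -Real.exp (-t ^ 2 / 2)) atTop (𝓝 0) := by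
    rw [← neg_zero]
    refine (Real.tendsto_exp_atBot.comp ?_).neg
    simp_rw [neg_div]
    exact tendsto_neg_atTop_atBot.comp ((tendsto_pow_atTop two_ne_zero).atTop_div_const two_pos)
  have hpos : ∀ t ∈ Set.Ioi x, 0 ≤ t * Real.exp (-t ^ 2 / 2) := fun t ht =>
    mul_nonneg (hx.trans ht).le (Real.exp_pos _).le
  have hint := integrableOn_Ioi_deriv_of_nonneg'
    (fun t _ => hasDerivAt_neg_exp_neg_sq_div_two t) hpos hlim
  have hval := integral_Ioi_of_hasDerivAt_of_nonneg'
    (fun t _ => hasDerivAt_neg_exp_neg_sq_div_two t) hpos hlim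
  have hle : ∫ t in Set.Ioi x, Real.exp (-t ^ 2 / 2) ≤ Real.exp (-x ^ 2 / 2) / x := by
    calc ∫ t in Set.Ioi x, Real.exp (-t ^ 2 / 2)
        ≤ ∫ t in Set.Ioi x, 1 / x * (t * Real.exp (-t ^ 2 / 2)) := by
          refine setIntegral_mono_on integrable_exp_neg_sq_div_two.integrableOn
            (hint.const_mul _) measurableSet_Ioi fun t ht => ?_
          rw [← mul_assoc]
          refine le_mul_of_one_le_left (Real.exp_pos _).le ?_
          rw [one_div_mul_eq_div, one_le_div hx]
          exact (Set.mem_Ioi.1 ht).le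
      _ = Real.exp (-x ^ 2 / 2) / x := by
          rw [integral_const_mul, hval]; ring
  have hone : 1 / Real.sqrt (2 * Real.pi) ≤ 1 := by
    rw [div_le_one (by positivity)]
    exact Real.one_le_sqrt.2 (by nlinarith [Real.pi_gt_three])
  calc gaussianQ x ≤ 1 * ∫ t in Set.Ioi x, Real.exp (-t ^ 2 / 2) :=
        mul_le_mul_of_nonneg_right hone (integral_nonneg fun _ => (Real.exp_pos _).le)
    _ ≤ _ := by rwa [one_mul]

/-! ### The Bessel function -/

lemma besselK_nonneg (ν x : ℝ) : 0 ≤ besselK ν x :=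
  integral_nonneg fun _ => mul_nonneg (Real.exp_pos _).le (Real.cosh_pos _).le

lemma sq_div_four_le_cosh (t : ℝ) : t ^ 2 / 4 ≤ Real.cosh t := by
  have h := Real.quadratic_le_exp_of_nonneg (abs_nonneg t)
  rw [← Real.cosh_abs, Real.cosh_eq]
  nlinarith [Real.exp_pos (-|t|), abs_nonneg t, sq_abs t]

/-- Gaussian domination: cosh t ≥ t²/4, cosh(νt) ≤ exp|νt|, and |ν||t| ≤ 2ν² + t²/8 because (4|ν| -
|t|)² ≥ 0. -/
lemma integrable_exp_neg_cosh_mul_cosh (ν : ℝ) :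
    Integrable fun t : ℝ => Real.exp (-1 * Real.cosh t) * Real.cosh (ν * t) := by
  have hg : Integrable fun t : ℝ => Real.exp (2 * ν ^ 2) * Real.exp (-(1 / 8) * t ^ 2) :=
    (integrable_exp_neg_mul_sq (by norm_num)).const_mul _
  refine hg.mono' (by fun_prop) (Eventually.of_forall fun t => ?_)
  rw [Real.norm_of_nonneg (mul_nonneg (Real.exp_pos _).le (Real.cosh_pos _).le)]
  have h1 : Real.cosh (ν * t) ≤ Real.exp |ν * t| := by
    rw [← Real.cosh_abs, Real.cosh_eq]
    have : Real.exp (-|ν * t|) ≤ Real.exp |ν * t| :=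
      Real.exp_le_exp.2 (by linarith [abs_nonneg (ν * t)])
    linarith
  calc _ ≤ Real.exp (-1 * Real.cosh t) * Real.exp |ν * t| := by gcongr
    _ ≤ _ := by
      rw [← Real.exp_add, ← Real.exp_add]
      refine Real.exp_le_exp.2 ?_
      rw [abs_mul]
      nlinarith [sq_div_four_le_cosh t, sq_nonneg (4 * |ν| - |t|), sq_abs t, sq_abs ν]

/-- Since cosh t ≥ 1, exp(-(x - 1) cosh t) ≤ exp(-(x - 1)). Only the exponential rate is needed, so
K_ν(1) can stay as a constant. -/
lemma besselK_le (ν : ℝ) {x : ℝ} (hx : 1 ≤ x) :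
    besselK ν x ≤ Real.exp (-(x - 1)) * besselK ν 1 := by
  unfold besselK
  rw [← integral_const_mul]
  refine integral_mono_of_nonneg
    (Eventually.of_forall fun t => mul_nonneg (Real.exp_pos _).le (Real.cosh_pos _).le)
    ((integrable_exp_neg_cosh_mul_cosh ν).integrableOn.const_mul _)
    (Eventually.of_forall fun t => ?_)
  dsimp only
  rw [← mul_assoc, ← Real.exp_add]
  refine mul_le_mul_of_nonneg_right (Real.exp_le_exp.2 ?_) (Real.cosh_pos _).le
  nlinarith [Real.one_le_cosh t]

lemma Psi_nonneg {η₀ lam : ℝ} (hη₀ : 0 ≤ η₀) (hlam : 0 ≤ lam) (l : ℕ) : 0 ≤ Psi η₀ l lam := by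
  unfold Psi
  have := Real.Gamma_nonneg_of_nonneg (show (0 : ℝ) ≤ (l : ℝ) / 2 by positivity)
  have := besselK_nonneg ((l : ℝ) / 2 - 1 / 2) (η₀ * lam / 2)
  positivity

/-- `Ψ(l, lam)` decays at least like `exp (-b lam)` for every `b < η₀ / 2`. -/
lemma tendsto_exp_mul_Psi {η₀ b : ℝ} (hη₀ : 0 < η₀) (hb : b < η₀ / 2) (l : ℕ) :
    Tendsto (fun lam => Real.exp (b * lam) * Psi η₀ l lam) atTop (𝓝 0) := by
  set ν : ℝ := (l : ℝ) / 2 - 1 / 2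
  set A : ℝ := Real.sqrt 2 / (2 ^ l * Real.Gamma ((l : ℝ) / 2))
  have hA : 0 ≤ A := by
    have := Real.Gamma_nonneg_of_nonneg (show (0 : ℝ) ≤ (l : ℝ) / 2 by positivity)
    positivity
  have h0 := (tendsto_rpow_mul_exp_neg_mul_atTop_nhds_zero ν (η₀ / 2 - b)
    (sub_pos.2 hb)).const_mul (A * η₀ ^ ν * Real.exp 1 * besselK ν 1)
  rw [mul_zero] at h0
  refine squeeze_zero' ?_ ?_ h0
  · filter_upwards [eventually_ge_atTop 0] with lam hlam
    exact mul_nonneg (Real.exp_pos _).le (Psi_nonneg hη₀.le hlam l)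
  · filter_upwards [eventually_ge_atTop 0, eventually_ge_atTop (2 / η₀)] with lam hlam hlam'
    have hx : 1 ≤ η₀ * lam / 2 := by
      rw [div_le_iff₀ hη₀] at hlam'
      linarith
    calc Real.exp (b * lam) * Psi η₀ l lam
        ≤ Real.exp (b * lam) * (A * (η₀ * lam) ^ ν *
            (Real.exp (-(η₀ * lam / 2 - 1)) * besselK ν 1)) := by
          unfold Psi
          gcongr
          exact besselK_le ν hx
      _ = A * η₀ ^ ν * Real.exp 1 * besselK ν 1 *
            (lam ^ ν * Real.exp (-(η₀ / 2 - b) * lam)) := by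
          rw [Real.mul_rpow hη₀.le hlam]
          have : Real.exp (-(η₀ / 2 - b) * lam) * Real.exp 1
              = Real.exp (b * lam) * Real.exp (-(η₀ * lam / 2 - 1)) := by
            rw [← Real.exp_add, ← Real.exp_add]; congr 1; ring
          linear_combination -(A * η₀ ^ ν * besselK ν 1 * lam ^ ν) * this

/-! ### Standard Gaussian vectors -/

section Gaussian

variable {E : Type*} [NormedAddCommGroup E] [InnerProductSpace ℝ E] [FiniteDimensional ℝ E]
  [MeasurableSpace E] [BorelSpace E]

lemma stdGaussian_map_inner {u : E} (hu : ‖u‖ = 1) :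
    (stdGaussian E).map (fun w => inner ℝ u w) = gaussianReal 0 1 := by
  have h := IsGaussian.map_eq_gaussianReal (μ := stdGaussian E) (innerSL ℝ u)
  rw [variance_dual_stdGaussian, integral_strongDual_stdGaussian, innerSL_apply_norm, hu] at h
  simpa using h

lemma stdGaussian_halfspace {e : E} (he : e ≠ 0) (x : ℝ) :
    (stdGaussian E).real {w | inner ℝ e w ≤ -(x * ‖e‖)} = gaussianQ x := by
  have hpos : 0 < ‖e‖ := norm_pos_iff.2 he
  have hu : ‖-(‖e‖⁻¹ • e)‖ = 1 := by
    rw [norm_neg, norm_smul, norm_inv, norm_norm, inv_mul_cancel₀ hpos.ne']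
  rw [← gaussianReal_Ici, ← stdGaussian_map_inner hu,
    map_measureReal_apply (by fun_prop) measurableSet_Ici]
  congr 1
  ext w
  simp only [Set.mem_ofPred_eq, Set.mem_preimage, Set.mem_Ici, inner_neg_left,
    real_inner_smul_left]
  rw [le_neg (a := x), inv_mul_eq_div, div_le_iff₀ hpos, neg_mul]

/-- The characteristic function at a functional depends only on its norm, and composing with the
projection, a contraction fixing U, preserves that norm. -/
lemma stdGaussian_map_orthogonalProjection (U : Submodule ℝ E) :
    (stdGaussian E).map U.orthogonalProjectionOnto = stdGaussian U := by
  apply Measure.ext_of_charFunDual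
  ext L
  have hn : ‖L.comp U.orthogonalProjectionOnto‖ = ‖L‖ := by
    refine le_antisymm ?_ ?_
    · refine (L.opNorm_comp_le _).trans ?_
      exact mul_le_of_le_one_right (norm_nonneg _) U.orthogonalProjectionOnto_norm_le
    · refine L.opNorm_le_bound (norm_nonneg _) fun u => ?_
      have := (L.comp U.orthogonalProjectionOnto).le_opNorm (u : E)
      simpa using this
  rw [charFunDual_map, charFunDual_stdGaussian, charFunDual_stdGaussian, hn]

/-- The exponential moment `E exp(3 g² / 8)` of the square of a standard Gaussian variable. -/
def expSqMoment : ℝ := ∫ x, Real.exp (3 / 8 * x ^ 2) ∂gaussianReal 0 1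

/-- The constant 3/8 is below 1/2, for integrability, and above 1/4, so that the final rate 2 ·
(3/8) η₀ = 3η₀/4 exceeds η₀/2. -/
lemma integrable_exp_sq_gaussianReal :
    Integrable (fun x : ℝ => Real.exp (3 / 8 * x ^ 2)) (gaussianReal 0 1) := by
  rw [gaussianReal_of_var_ne_zero _ one_ne_zero,
    integrable_withDensity_iff (measurable_gaussianPDF _ _)
      (Eventually.of_forall fun _ => gaussianPDF_lt_top)]
  have h := (integrable_exp_neg_mul_sq (b := 1 / 8) (by norm_num)).const_mul
    (Real.sqrt (2 * Real.pi))⁻¹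
  refine h.congr (Eventually.of_forall fun x => ?_)
  simp only [toReal_gaussianPDF, gaussianPDFReal, NNReal.coe_one, mul_one, sub_zero]
  rw [mul_left_comm, ← Real.exp_add]
  congr 2
  ring

lemma one_le_expSqMoment : 1 ≤ expSqMoment := by
  have h : ∫ _ : ℝ, (1 : ℝ) ∂gaussianReal 0 1 ≤ expSqMoment :=
    integral_mono (integrable_const _) integrable_exp_sq_gaussianReal
      fun x => Real.one_le_exp (by positivity)
  simpa using h

lemma stdGaussian_map_norm_sq :
    Integrable (fun w : E => Real.exp (3 / 8 * ‖w‖ ^ 2)) (stdGaussian E) ∧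
      ∫ w : E, Real.exp (3 / 8 * ‖w‖ ^ 2) ∂stdGaussian E
        = expSqMoment ^ Module.finrank ℝ E := by
  have hm : Measurable fun x : Fin (Module.finrank ℝ E) → ℝ =>
      ∑ i, x i • stdOrthonormalBasis ℝ E i := by fun_prop
  have heq : ∀ x : Fin (Module.finrank ℝ E) → ℝ,
      Real.exp (3 / 8 * ‖∑ i, x i • stdOrthonormalBasis ℝ E i‖ ^ 2)
        = ∏ i, Real.exp (3 / 8 * x i ^ 2) := fun x => by
    rw [← Real.exp_sum, ← Finset.mul_sum, ← (stdOrthonormalBasis ℝ E).sum_sq_inner_right]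
    congr 2
    refine Finset.sum_congr rfl fun i _ => ?_
    rw [(stdOrthonormalBasis ℝ E).orthonormal.inner_right_fintype]
  constructor
  · rw [stdGaussian, integrable_map_measure (by fun_prop) hm.aemeasurable]
    simp only [Function.comp_def, heq]
    exact Integrable.fintype_prod fun _ => integrable_exp_sq_gaussianReal
  · rw [stdGaussian, integral_map hm.aemeasurable (by fun_prop)]
    simp only [heq]
    rw [integral_fintype_prod_eq_pow (fun x : ℝ => Real.exp (3 / 8 * x ^ 2)), Fintype.card_fin,
      expSqMoment]

/-- Markov's inequality for exp(3‖u‖²/8) on U. The moment is at least 1, so its power dim U may be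
raised to k. -/
lemma stdGaussian_projection_tail (U : Submodule ℝ E) {k : ℕ} (hU : Module.finrank ℝ U ≤ k)
    (x : ℝ) :
    (stdGaussian E).real {w | x ≤ ‖U.orthogonalProjectionOnto w‖ ^ 2}
      ≤ expSqMoment ^ k * Real.exp (-(3 / 8 * x)) := by
  have h1 : (stdGaussian E).real {w | x ≤ ‖U.orthogonalProjectionOnto w‖ ^ 2}
      = (stdGaussian U).real {u | Real.exp (3 / 8 * x) ≤ Real.exp (3 / 8 * ‖u‖ ^ 2)} := by
    rw [← stdGaussian_map_orthogonalProjection U, map_measureReal_apply (by fun_prop)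
      (measurableSet_le (by fun_prop) (by fun_prop))]
    congr 1
    ext w
    simp
  have h2 := mul_meas_ge_le_integral_of_nonneg
    (Eventually.of_forall fun u : U => (Real.exp_pos (3 / 8 * ‖u‖ ^ 2)).le)
    (stdGaussian_map_norm_sq (E := U)).1 (Real.exp (3 / 8 * x))
  rw [stdGaussian_map_norm_sq.2] at h2
  rw [h1, Real.exp_neg, ← div_eq_mul_inv, le_div_iff₀' (Real.exp_pos _)]
  exact h2.trans (pow_le_pow_right₀ one_le_expSqMoment hU)

end Gaussian

/-! ### Reduction to standard noise, and a Pythagorean inequality -/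

open scoped MatrixOrder in
lemma multivariateGaussian_smul_one {M : ℕ} (μ : EuclideanSpace ℝ (Fin M)) {σ : ℝ}
    (hσ : 0 < σ) :
    multivariateGaussian μ (σ ^ 2 • (1 : Matrix (Fin M) (Fin M) ℝ))
      = (stdGaussian (EuclideanSpace ℝ (Fin M))).map fun w => μ + σ • w := by
  have hs : CFC.sqrt (σ ^ 2 • (1 : Matrix (Fin M) (Fin M) ℝ)) = σ • 1 := by
    refine CFC.sqrt_unique ?_ ?_
    · simp [smul_smul, sq]
    · exact (Matrix.PosSemidef.one.smul hσ.le).nonneg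
  rw [multivariateGaussian, hs]
  simp

/-- The sampling operator as a linear map. -/
def samplingLinearMap {H : Type*} [NormedAddCommGroup H] [InnerProductSpace ℝ H] {M : ℕ}
    (a : Fin M → H) : H →ₗ[ℝ] EuclideanSpace ℝ (Fin M) where
  toFun := sampling a
  map_add' x y := by ext m; simp [sampling, inner_add_left]
  map_smul' r x := by ext m; simp [sampling, real_inner_smul_left]

/-- If `d + w` is at most as far from `U` as `w` is from the origin, the component `e` of `d`
orthogonal to `U` satisfies `‖e‖² + 2 ⟨e, w⟩ ≤ ‖P_U w‖²`. -/
lemma norm_sq_add_two_mul_inner_le {E : Type*} [NormedAddCommGroup E] [InnerProductSpace ℝ E]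
    [FiniteDimensional ℝ E] (U : Submodule ℝ E) (d w : E)
    (h : ‖Uᗮ.orthogonalProjectionOnto (d + w)‖ ≤ ‖w‖) :
    ‖Uᗮ.orthogonalProjectionOnto d‖ ^ 2 + 2 * inner ℝ (Uᗮ.orthogonalProjectionOnto d : E) w
      ≤ ‖U.orthogonalProjectionOnto w‖ ^ 2 := by
  have h1 := pow_le_pow_left₀ (norm_nonneg _) h 2
  -- By Pythagoras for w, the squared norm of its component in Uᗮ appears on both sides and cancels.
  rw [U.norm_sq_eq_add_norm_sq_projection w, map_add, norm_add_sq_real,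
    Submodule.inner_orthogonalProjectionOnto_eq_of_mem_left] at h1
  linarith

/-! ### Geometry of the ranges R(B_i) and the levels -/

namespace Problem

variable {H : Type*} [NormedAddCommGroup H] [InnerProductSpace ℝ H] {k T M : ℕ}

lemma rangeB_eq_map (p : Problem H k T M) (i : Fin T) :
    p.rangeB i = (subspace p.v i).map (samplingLinearMap p.a) := by
  rw [rangeB, subspace, Submodule.map_span, ← Set.range_comp]
  rfl

lemma finrank_rangeB_le (p : Problem H k T M) (i : Fin T) :
    Module.finrank ℝ (p.rangeB i) ≤ k :=
  (finrank_range_le_card (R := ℝ) (p.b i)).trans_eq (Fintype.card_fin k)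

lemma Bmul_mem_rangeB (p : Problem H k T M) (i : Fin T) (c : Fin k → ℝ) :
    p.Bmul i c ∈ p.rangeB i :=
  Submodule.sum_mem _ fun m _ => Submodule.smul_mem _ _ (Submodule.subset_span ⟨m, rfl⟩)

/-- The dropped columns lie in R(B_i), so the full signal and its reduced part have the same
component orthogonal to R(B_i). -/
lemma Bmul_sub_Bdiff_mem_rangeB (p : Problem H k T M) (j i : Fin T) :
    p.Bmul j (p.c j) - p.Bdiff j i ∈ p.rangeB i := by
  classical
  have h : p.Bmul j (p.c j) - p.Bdiff j i = ∑ m ∈ (p.W j i)ᶜ, p.c j m • p.b j m := by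
    rw [sub_eq_iff_eq_add, Bmul, Bdiff, Finset.sum_compl_add_sum]
  rw [h]
  refine Submodule.sum_mem _ fun m hm => Submodule.smul_mem _ _ ?_
  simpa [W] using hm

/-- If W were empty, A S_j would lie in A S_i; injectivity on the union would then give S_j ⊆ S_i.
-/
lemma card_W_mem_Icc (p : Problem H k T M) {j i : Fin T} (hij : i ≠ j) :
    (p.W j i).card ∈ Finset.Icc 1 k := by
  refine Finset.mem_Icc.2 ⟨?_, by simpa using (p.W j i).card_le_univ⟩
  by_contra hlt
  have hW : p.W j i = ∅ := Finset.card_eq_zero.1 (by omega)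
  refine p.not_le j i hij.symm (Submodule.span_le.2 ?_)
  rintro _ ⟨m, rfl⟩
  have hm : p.b j m ∈ p.rangeB i := by
    by_contra hm
    have : m ∈ p.W j i := by simp [W, hm]
    simp [hW] at this
  rw [rangeB_eq_map] at hm
  obtain ⟨s, hs, hsm⟩ := hm
  have hv : p.v j m ∈ subspace p.v j := Submodule.subset_span ⟨m, rfl⟩
  rw [← p.injOn (Set.mem_iUnion_of_mem i hs) (Set.mem_iUnion_of_mem j hv) hsm]
  exact hs

lemma Tj_le_T₀ (p : Problem H k T M) (j : Fin T) (l : ℕ) : p.Tj j l ≤ p.T₀ l :=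
  Finset.le_sup (f := fun j => p.Tj j l) (Finset.mem_univ j)

lemma T₀_card_W_pos (p : Problem H k T M) {j i : Fin T} (hij : i ≠ j) :
    0 < p.T₀ (p.W j i).card := by
  classical
  refine lt_of_lt_of_le (Finset.card_pos.2 ⟨i, ?_⟩) (p.Tj_le_T₀ j _)
  simp [hij]

lemma αmin_nonneg (p : Problem H k T M) (q : p.Eigenbasis) (l : ℕ) : 0 ≤ p.αmin q l :=
  Real.sInf_nonneg (by rintro _ ⟨j, i, m, -, -, rfl⟩; exact abs_nonneg _)

lemma αmin_le (p : Problem H k T M) (q : p.Eigenbasis) {j i : Fin T} (hij : i ≠ j)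
    (m : Fin (M - k)) : p.αmin q (p.W j i).card ≤ |p.α q j i m| :=
  csInf_le ⟨0, by rintro _ ⟨j, i, m, -, -, rfl⟩; exact abs_nonneg _⟩ ⟨j, i, m, hij, rfl, rfl⟩

/-- Parseval: each of the M - k coordinates is at least σ α_min in absolute value. -/
lemma sq_mul_snr_le (p : Problem H k T M) (q : p.Eigenbasis) {j i : Fin T} (hij : i ≠ j) :
    p.σ ^ 2 * p.snr q (p.W j i).card
      ≤ ‖(p.rangeB i)ᗮ.orthogonalProjectionOnto (p.Bdiff j i)‖ ^ 2 := by
  rw [← (q i).sum_sq_inner_right]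
  have hm : ∀ m, p.σ ^ 2 * p.αmin q (p.W j i).card ^ 2
      ≤ inner ℝ (q i m) ((p.rangeB i)ᗮ.orthogonalProjectionOnto (p.Bdiff j i)) ^ 2 := fun m => by
    have h1 : inner ℝ (q i m) ((p.rangeB i)ᗮ.orthogonalProjectionOnto (p.Bdiff j i))
        = p.σ * p.α q j i m := by
      rw [Submodule.inner_orthogonalProjectionOnto_eq_of_mem_left, α, ← mul_assoc,
        mul_one_div_cancel p.σ_pos.ne', one_mul]
    rw [h1, mul_pow, ← sq_abs (p.α q j i m)]
    exact mul_le_mul_of_nonneg_left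
      (pow_le_pow_left₀ (p.αmin_nonneg q _) (p.αmin_le q hij m) 2) (sq_nonneg _)
  -- `snr` subtracts in ℝ, while the basis is indexed with truncated subtraction, which is never
  -- smaller.
  have hMk : (M : ℝ) - k ≤ ((M - k : ℕ) : ℝ) := by
    rw [sub_le_iff_le_add]
    exact_mod_cast (by omega : M ≤ M - k + k)
  calc p.σ ^ 2 * p.snr q (p.W j i).card
      ≤ ((M - k : ℕ) : ℝ) * (p.σ ^ 2 * p.αmin q (p.W j i).card ^ 2) := by
        rw [snr, mul_left_comm]
        exact mul_le_mul_of_nonneg_right hMk (by positivity)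
    _ ≤ _ := by
        simpa using Finset.card_nsmul_le_sum Finset.univ _ _ fun m _ => hm m

/-! ### The probability of error -/

instance (p : Problem H k T M) (j : Fin T) : IsProbabilityMeasure (p.law j) := by
  unfold law; infer_instance

lemma law_eq_map (p : Problem H k T M) (j : Fin T) :
    p.law j = (stdGaussian (EuclideanSpace ℝ (Fin M))).map
      fun w => p.Bmul j (p.c j) + p.σ • w :=
  multivariateGaussian_smul_one _ p.σ_pos

/-- A maximum likelihood estimator minimizes the distance of the observation to the ranges. -/
lemma IsMLEstimator.exists_norm_sub_le {p : Problem H k T M}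
    {ζ : EuclideanSpace ℝ (Fin M) → Fin T} (hζ : p.IsMLEstimator ζ)
    (y : EuclideanSpace ℝ (Fin M)) (j : Fin T) (c' : Fin k → ℝ) :
    ∃ c, ‖y - p.Bmul (ζ y) c‖ ≤ ‖y - p.Bmul j c'‖ := by
  obtain ⟨c, hc⟩ := hζ.isMax y
  refine ⟨c, ?_⟩
  have h := hc j c'
  have hσ := p.σ_pos
  unfold likelihood at h
  rw [mul_le_mul_iff_right₀ (by positivity), Real.exp_le_exp,
    div_le_div_iff_of_pos_right (by positivity), neg_le_neg_iff] at h
  exact (pow_le_pow_iff_left₀ (norm_nonneg _) (norm_nonneg _) two_ne_zero).1 h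

/-- The bound on the probability that a subspace with `|W_{j∖i}| = l` is preferred to the true
one. -/
def pairBound (p : Problem H k T M) (q : p.Eigenbasis) (η₀ : ℝ) (l : ℕ) : ℝ :=
  gaussianQ (1 / 2 * (1 - 2 * η₀) * Real.sqrt (p.snr q l)) +
    expSqMoment ^ k * Real.exp (-(3 / 4 * η₀ * p.snr q l))

lemma pairBound_nonneg (p : Problem H k T M) (q : p.Eigenbasis) (η₀ : ℝ) (l : ℕ) :
    0 ≤ p.pairBound q η₀ l :=
  add_nonneg (gaussianQ_nonneg _)
    (mul_nonneg (pow_nonneg (zero_le_one.trans one_le_expSqMoment) _) (Real.exp_pos _).le)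

/-- The energy ‖e‖² is split: a share 2η₀ against the projected noise, the rest against the cross
term. If both stayed below their shares, `i` could not win. Positivity of `snr` gives e ≠ 0. -/
lemma law_eq_le_pairBound (p : Problem H k T M) (q : p.Eigenbasis) {η₀ : ℝ} (hη₀ : 0 < η₀)
    (hη₀' : η₀ < 1 / 2) {ζ : EuclideanSpace ℝ (Fin M) → Fin T} (hζ : p.IsMLEstimator ζ)
    {j i : Fin T} (hij : i ≠ j) (hsnr : 0 < p.snr q (p.W j i).card) :
    (p.law j).real {y | ζ y = i} ≤ p.pairBound q η₀ (p.W j i).card := by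
  have hσ := p.σ_pos
  set U := p.rangeB i with hU
  set e := Uᗮ.orthogonalProjectionOnto (p.Bdiff j i) with he
  set s := p.snr q (p.W j i).card with hs
  have hse : p.σ ^ 2 * s ≤ ‖e‖ ^ 2 := p.sq_mul_snr_le q hij
  have hs' : s ≤ (‖e‖ / p.σ) ^ 2 := by
    rw [div_pow, le_div_iff₀ (by positivity)]; linarith
  have hpos : 0 < ‖e‖ := by
    have : 0 < ‖e‖ ^ 2 := lt_of_lt_of_le (by positivity) hse
    exact (norm_nonneg e).lt_of_ne fun h => by simp [← h] at this
  have he0 : (e : EuclideanSpace ℝ (Fin M)) ≠ 0 := by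
    rw [← norm_pos_iff]; simpa using hpos
  set x := 1 / 2 * (1 - 2 * η₀) * (‖e‖ / p.σ) with hx
  have hsub : {w | ζ (p.Bmul j (p.c j) + p.σ • w) = i} ⊆
      {w | inner ℝ (e : EuclideanSpace ℝ (Fin M)) w ≤ -(x * ‖(e : EuclideanSpace ℝ (Fin M))‖)} ∪
        {w | 2 * η₀ * (‖e‖ / p.σ) ^ 2 ≤ ‖U.orthogonalProjectionOnto w‖ ^ 2} := by
    intro w hw
    rw [Set.mem_ofPred_eq] at hw
    -- Comparing with the true coefficients, not the best fit in R(B_j), makes the residual exactly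
    -- σw.
    obtain ⟨c, hc⟩ := hζ.exists_norm_sub_le (p.Bmul j (p.c j) + p.σ • w) j (p.c j)
    rw [hw, add_sub_cancel_left] at hc
    have hproj : Uᗮ.orthogonalProjectionOnto (p.Bdiff j i + p.σ • w)
        = Uᗮ.orthogonalProjectionOnto (p.Bmul j (p.c j) + p.σ • w - p.Bmul i c) := by
      rw [← sub_eq_zero, ← map_sub, Submodule.orthogonalProjectionOnto_eq_zero_iff,
        Submodule.orthogonal_orthogonal]
      have := U.sub_mem (p.Bmul_mem_rangeB i c) (p.Bmul_sub_Bdiff_mem_rangeB j i)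
      convert this using 1
      abel
    have hle := norm_sq_add_two_mul_inner_le U (p.Bdiff j i) (p.σ • w) (by
      rw [hproj]
      exact (Uᗮ.norm_orthogonalProjectionOnto_apply_le _).trans hc)
    rw [← he, real_inner_smul_right, map_smul, norm_smul, mul_pow, Real.norm_of_nonneg hσ.le] at hle
    rw [Set.mem_union, Set.mem_ofPred_eq, Set.mem_ofPred_eq]
    by_contra! hcon
    obtain ⟨h1, h2⟩ := hcon
    rw [← Submodule.coe_norm] at h1
    have h3 : p.σ ^ 2 * ‖U.orthogonalProjectionOnto w‖ ^ 2 < 2 * η₀ * ‖e‖ ^ 2 := by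
      have := mul_lt_mul_of_pos_left h2 (pow_pos hσ 2)
      rwa [show p.σ ^ 2 * (2 * η₀ * (‖e‖ / p.σ) ^ 2) = 2 * η₀ * ‖e‖ ^ 2 by field_simp] at this
    have h4 : -((1 - 2 * η₀) * ‖e‖ ^ 2)
        < 2 * (p.σ * inner ℝ (e : EuclideanSpace ℝ (Fin M)) w) := by
      have := mul_lt_mul_of_pos_left h1 (mul_pos two_pos hσ)
      rwa [show 2 * p.σ * -(x * ‖e‖) = -((1 - 2 * η₀) * ‖e‖ ^ 2) by rw [hx]; field_simp,
        mul_assoc] at this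
    linarith
  have hmeas : MeasurableSet {y | ζ y = i} := hζ.measurable (measurableSet_singleton i)
  rw [law_eq_map, map_measureReal_apply (by fun_prop) hmeas]
  refine (measureReal_mono hsub).trans ((measureReal_union_le _ _).trans (add_le_add ?_ ?_))
  · rw [stdGaussian_halfspace he0]
    refine gaussianQ_antitone ?_
    rw [hx]
    have : Real.sqrt s ≤ ‖e‖ / p.σ := Real.sqrt_le_iff.2 ⟨by positivity, hs'⟩
    exact mul_le_mul_of_nonneg_left this (by linarith)
  · refine (stdGaussian_projection_tail U (p.finrank_rangeB_le i) _).trans ?_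
    refine mul_le_mul_of_nonneg_left (Real.exp_le_exp.2 ?_)
      (pow_nonneg (zero_le_one.trans one_le_expSqMoment) _)
    have := mul_le_mul_of_nonneg_left hs' hη₀.le
    linarith

lemma errorProb_nonneg (p : Problem H k T M) (ζ : EuclideanSpace ℝ (Fin M) → Fin T) :
    0 ≤ p.errorProb ζ :=
  Finset.sum_nonneg fun _ _ => mul_nonneg measureReal_nonneg (by positivity)

lemma errorProb_le (p : Problem H k T M) (q : p.Eigenbasis) {η₀ : ℝ} (hη₀ : 0 < η₀)
    (hη₀' : η₀ < 1 / 2) {ζ : EuclideanSpace ℝ (Fin M) → Fin T} (hζ : p.IsMLEstimator ζ)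
    (hsnr : ∀ l ∈ Finset.Icc 1 k, 0 < p.T₀ l → 0 < p.snr q l) :
    p.errorProb ζ ≤ ∑ l ∈ Finset.Icc 1 k, (p.T₀ l : ℝ) * p.pairBound q η₀ l := by
  classical
  have hj : ∀ j, (p.law j).real {y | ζ y ≠ j}
      ≤ ∑ l ∈ Finset.Icc 1 k, (p.T₀ l : ℝ) * p.pairBound q η₀ l := fun j => by
    have hset : {y | ζ y ≠ j} = ⋃ i ∈ Finset.univ.filter (· ≠ j), {y | ζ y = i} := by
      ext y; simp
    calc (p.law j).real {y | ζ y ≠ j}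
        ≤ ∑ i ∈ Finset.univ.filter (· ≠ j), (p.law j).real {y | ζ y = i} := by
          rw [hset]; exact measureReal_biUnion_finset_le _ _
      _ ≤ ∑ i ∈ Finset.univ.filter (· ≠ j), p.pairBound q η₀ (p.W j i).card := by
          refine Finset.sum_le_sum fun i hi => ?_
          have hij : i ≠ j := (Finset.mem_filter.1 hi).2
          exact p.law_eq_le_pairBound q hη₀ hη₀' hζ hij
            (hsnr _ (p.card_W_mem_Icc hij) (p.T₀_card_W_pos hij))
      _ = ∑ l ∈ Finset.Icc 1 k, (p.Tj j l : ℝ) * p.pairBound q η₀ l := by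
          rw [← Finset.sum_fiberwise_of_maps_to (t := Finset.Icc 1 k)
            (g := fun i => (p.W j i).card)
            fun i hi => p.card_W_mem_Icc (Finset.mem_filter.1 hi).2]
          refine Finset.sum_congr rfl fun l _ => ?_
          rw [Finset.sum_congr rfl (g := fun _ => p.pairBound q η₀ l)
            fun i hi => by rw [(Finset.mem_filter.1 hi).2], Finset.sum_const, nsmul_eq_mul,
            Finset.filter_filter, Tj]
      _ ≤ _ := by
          refine Finset.sum_le_sum fun l _ => mul_le_mul_of_nonneg_right ?_
            (p.pairBound_nonneg q η₀ l)
          exact_mod_cast p.Tj_le_T₀ j l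
  have hnn : 0 ≤ ∑ l ∈ Finset.Icc 1 k, (p.T₀ l : ℝ) * p.pairBound q η₀ l :=
    Finset.sum_nonneg fun l _ => mul_nonneg (Nat.cast_nonneg _) (p.pairBound_nonneg q η₀ l)
  calc p.errorProb ζ
      ≤ ∑ _j : Fin T, (∑ l ∈ Finset.Icc 1 k, (p.T₀ l : ℝ) * p.pairBound q η₀ l) * (1 / (T : ℝ)) :=
        Finset.sum_le_sum fun j _ => mul_le_mul_of_nonneg_right (hj j) (by positivity)
    _ = (∑ l ∈ Finset.Icc 1 k, (p.T₀ l : ℝ) * p.pairBound q η₀ l) * ((T : ℝ) / T) := by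
        rw [Finset.sum_const, Finset.card_univ, Fintype.card_fin, nsmul_eq_mul]; ring
    -- Using T/T ≤ 1 covers T = 0, where the quotient is 0.
    _ ≤ _ := mul_le_of_le_one_right hnn (div_self_le_one _)

end Problem

/-! ### Products of a counting factor and a decaying one -/

/-- Growth of `snr` is known only where T₀(l) > 0; elsewhere the summand of level l is zero. -/
lemma tendsto_zero_of_tendsto_principal {ι : Type*} {F : Filter ι} {f : ι → ℝ} {s : Set ι}
    (h : Tendsto f (F ⊓ 𝓟 s) (𝓝 0)) (h0 : ∀ n ∉ s, f n = 0) : Tendsto f F (𝓝 0) := by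
  have hF : F = F ⊓ 𝓟 s ⊔ F ⊓ 𝓟 sᶜ := by
    rw [← inf_sup_left, sup_principal, Set.union_compl_self, principal_univ, inf_top_eq]
  rw [hF]
  exact h.sup (tendsto_const_nhds.congr' (by
    filter_upwards [mem_inf_of_right (mem_principal_self sᶜ)] with n hn
    exact (h0 n hn).symm))

lemma tendsto_mul_gaussianQ {ι : Type*} {F : Filter ι} {t x : ι → ℝ} {C : ℝ}
    (hx : Tendsto x F atTop) (ht0 : ∀ n, 0 ≤ t n)
    (ht : ∀ᶠ n in F, t n ≤ C * Real.exp (x n ^ 2 / 2)) :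
    Tendsto (fun n => t n * gaussianQ (x n)) F (𝓝 0) := by
  refine squeeze_zero' (Eventually.of_forall fun n => mul_nonneg (ht0 n) (gaussianQ_nonneg _))
    ?_ (hx.const_div_atTop C)
  filter_upwards [ht, hx.eventually_gt_atTop 0] with n hn hpos
  calc t n * gaussianQ (x n)
      ≤ C * Real.exp (x n ^ 2 / 2) * (Real.exp (-x n ^ 2 / 2) / x n) :=
        mul_le_mul hn (gaussianQ_le hpos) (gaussianQ_nonneg _) ((ht0 n).trans hn)
    _ = C / x n := by
        rw [mul_assoc, mul_div_assoc', ← Real.exp_add]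
        ring_nf
        simp

lemma tendsto_mul_of_le_exp {ι : Type*} {F : Filter ι} {t x : ι → ℝ} {g : ℝ → ℝ} {C b : ℝ}
    (hx : Tendsto x F atTop) (ht0 : ∀ n, 0 ≤ t n)
    (ht : ∀ᶠ n in F, t n ≤ C * Real.exp (b * x n)) (hg0 : ∀ y, 0 ≤ y → 0 ≤ g y)
    (hg : Tendsto (fun y => Real.exp (b * y) * g y) atTop (𝓝 0)) :
    Tendsto (fun n => t n * g (x n)) F (𝓝 0) := by
  have h := (hg.comp hx).const_mul C
  rw [mul_zero] at h
  refine squeeze_zero' ?_ ?_ h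
  · filter_upwards [hx.eventually_ge_atTop 0] with n hn
    exact mul_nonneg (ht0 n) (hg0 _ hn)
  · filter_upwards [hx.eventually_ge_atTop 0, ht] with n hn htn
    rw [Function.comp_apply, ← mul_assoc]
    exact mul_le_mul_of_nonneg_right htn (hg0 _ hn)

/-! ### From sample-size thresholds to bounds on T₀ -/

namespace Problem

variable {H : Type*} [NormedAddCommGroup H] [InnerProductSpace ℝ H] {k T M : ℕ}

/-- Finiteness makes the `sSup` in `M₁` and `M₂` a true upper bound. -/
lemma finite_levels (p : Problem H k T M) : p.levels.Finite :=
  (Set.finite_Icc 1 k).subset fun _ hl => ⟨hl.1, hl.2.1⟩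

/-- A sample size above a threshold `A / α² * L` bounds `L` by the signal-to-noise ratio. -/
lemma lt_of_threshold_lt (p : Problem H k T M) (q : p.Eigenbasis) {l : ℕ} {A B L : ℝ}
    (hA : 0 < A) (hB : 0 < B) (hsnr : 0 < p.snr q l)
    (h : A / (B * p.αmin q l ^ 2) * L < (M : ℝ) - k) :
    L < B / A * p.snr q l := by
  -- If α_min were 0, the threshold would be a division by zero and carry no information.
  have hα : 0 < p.αmin q l ^ 2 := by
    refine (sq_nonneg _).lt_of_ne fun h0 => ?_
    rw [snr, ← h0, mul_zero] at hsnr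
    exact lt_irrefl _ hsnr
  rw [div_mul_eq_mul_div, div_lt_iff₀ (by positivity)] at h
  rw [snr, div_mul_eq_mul_div, lt_div_iff₀ hA]
  linarith

lemma T₀_le_of_M₁_lt (p : Problem H k T M) (q : p.Eigenbasis) {η₀ : ℝ} (hη₀' : η₀ < 1 / 2)
    {l : ℕ} (hl : l ∈ p.levels) (hsnr : 0 < p.snr q l) (h : p.M₁ q η₀ < (M : ℝ) - k) :
    (p.T₀ l : ℝ)
      ≤ 2 * Real.exp ((1 / 2 * (1 - 2 * η₀) * Real.sqrt (p.snr q l)) ^ 2 / 2) := by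
  have hf : p.f₁ q η₀ l < (M : ℝ) - k :=
    (le_csSup (p.finite_levels.image _).bddAbove ⟨l, hl, rfl⟩).trans_lt h
  have hT : (0 : ℝ) < p.T₀ l := Nat.cast_pos.2 hl.2.2
  have hlt := p.lt_of_threshold_lt q (by norm_num) (pow_pos (by linarith) 2) hsnr hf
  rw [← Real.log_mul hT.ne' (by norm_num), Real.log_lt_iff_lt_exp (by positivity)] at hlt
  rw [mul_pow, Real.sq_sqrt hsnr.le,
    show (1 / 2 * (1 - 2 * η₀)) ^ 2 * p.snr q l / 2 = (1 - 2 * η₀) ^ 2 / 8 * p.snr q l by ring]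
  linarith

/-- Of b₀ only its positivity matters here: it affects the constant, not the rate. -/
lemma T₀_le_of_M₂_lt (p : Problem H k T M) (q : p.Eigenbasis) {η₀ r₀ : ℝ} (hη₀ : 0 < η₀)
    (hr₀ : 0 < r₀) (hk : 0 < (k : ℝ) / 2 + r₀ - 1) {l : ℕ} (hl : l ∈ p.levels)
    (hsnr : 0 < p.snr q l) (h : p.M₂ q η₀ r₀ < (M : ℝ) - k) :
    (p.T₀ l : ℝ) ≤ (2 * b₀ / Real.sqrt Real.pi)⁻¹ *
      Real.exp (r₀ * η₀ / (2 * ((k : ℝ) / 2 + r₀ - 1)) * p.snr q l) := by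
  have hf : p.f₂ q η₀ r₀ l < (M : ℝ) - k :=
    (le_csSup (p.finite_levels.image _).bddAbove ⟨l, hl, rfl⟩).trans_lt h
  have hT : (0 : ℝ) < p.T₀ l := Nat.cast_pos.2 hl.2.2
  have hc : 0 < 2 * b₀ / Real.sqrt Real.pi := by unfold b₀; positivity
  have hlt := p.lt_of_threshold_lt q (by linarith) (mul_pos hr₀ hη₀) hsnr hf
  rw [← Real.log_mul hT.ne' hc.ne', Real.log_lt_iff_lt_exp (by positivity)] at hlt
  rw [inv_mul_eq_div, le_div_iff₀ hc]
  exact hlt.le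

end Problem

end SubspaceRecovery

end

open SubspaceRecovery in
theorem theorem2 (k : ℕ) (η₀ r₀ : ℝ) (hη₀ : 0 < η₀) (hη₀' : η₀ < 1 / 2) (hr₀ : 0 < r₀)
    (H : ℕ → Type*) [∀ n, NormedAddCommGroup (H n)] [∀ n, InnerProductSpace ℝ (H n)]
    [∀ n, CompleteSpace (H n)] (T M : ℕ → ℕ)
    (p : ∀ n, SubspaceRecovery.Problem (H n) k (T n) (M n))
    (q : ∀ n, (p n).Eigenbasis)
    (ζ : ∀ n, EuclideanSpace ℝ (Fin (M n)) → Fin (T n))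
    (hζ : ∀ n, (p n).IsMLEstimator (ζ n))
    (hk : 3 ≤ k ∨ ∃ C : ℕ, ∀ n l, (p n).T₀ l ≤ C)
    (hM : Tendsto (fun n => (M n : ℝ) - k) atTop atTop)
    (hsnr : ∀ l, 1 ≤ l → l ≤ k →
      Tendsto (fun n => (p n).snr (q n) l) (atTop ⊓ 𝓟 {n | 0 < (p n).T₀ l}) atTop)
    (hcond : ∀ᶠ n in atTop, (M n : ℝ) > k + max ((p n).M₁ (q n) η₀) ((p n).M₂ (q n) η₀ r₀)) :
    Tendsto (fun n => (p n).errorBound (q n) η₀) atTop (𝓝 0) ∧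
      Tendsto (fun n => (p n).errorProb (ζ n)) atTop (𝓝 0) := by
  have hev : ∀ l, 1 ≤ l → l ≤ k → ∀ᶠ n in atTop ⊓ 𝓟 {n | 0 < (p n).T₀ l},
      l ∈ (p n).levels ∧ 0 < (p n).snr (q n) l ∧ (p n).M₁ (q n) η₀ < (M n : ℝ) - k ∧
        (p n).M₂ (q n) η₀ r₀ < (M n : ℝ) - k := fun l h1 hlk => by
    filter_upwards [mem_inf_of_right (mem_principal_self _), hcond.filter_mono inf_le_left,
      (hsnr l h1 hlk).eventually_gt_atTop 0] with n hn hc hs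
    exact ⟨⟨h1, hlk, hn⟩, hs, by linarith [le_max_left ((p n).M₁ (q n) η₀) ((p n).M₂ (q n) η₀ r₀)],
      by linarith [le_max_right ((p n).M₁ (q n) η₀) ((p n).M₂ (q n) η₀ r₀)]⟩
  obtain ⟨C, b, hb, hTb⟩ : ∃ C b : ℝ, b < η₀ / 2 ∧ ∀ l, 1 ≤ l → l ≤ k →
      ∀ᶠ n in atTop ⊓ 𝓟 {n | 0 < (p n).T₀ l},
        ((p n).T₀ l : ℝ) ≤ C * Real.exp (b * (p n).snr (q n) l) := by
    rcases hk with hk | ⟨C, hC⟩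
    · have hk' : (3 : ℝ) ≤ k := by exact_mod_cast hk
      have hpos : 0 < (k : ℝ) / 2 + r₀ - 1 := by linarith
      refine ⟨(2 * b₀ / Real.sqrt Real.pi)⁻¹, r₀ * η₀ / (2 * ((k : ℝ) / 2 + r₀ - 1)), ?_, fun l h1 hlk => ?_⟩
      -- The inequality amounts to r₀ < k/2 + r₀ - 1, that is, k > 2.
      · rw [div_lt_div_iff₀ (by linarith) two_pos]
        nlinarith
      · filter_upwards [hev l h1 hlk] with n hn
        exact (p n).T₀_le_of_M₂_lt (q n) hη₀ hr₀ hpos hn.1 hn.2.1 hn.2.2.2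
    · refine ⟨C, 0, by linarith, fun l _ _ => Eventually.of_forall fun n => ?_⟩
      simpa using hC n l
  have hQ : ∀ l, 1 ≤ l → l ≤ k → Tendsto (fun n => ((p n).T₀ l : ℝ) *
      gaussianQ (1 / 2 * (1 - 2 * η₀) * Real.sqrt ((p n).snr (q n) l)))
      (atTop ⊓ 𝓟 {n | 0 < (p n).T₀ l}) (𝓝 0) := fun l h1 hlk => by
    refine tendsto_mul_gaussianQ (C := 2) ?_ (fun n => Nat.cast_nonneg _) ?_
    · exact (Real.tendsto_sqrt_atTop.comp (hsnr l h1 hlk)).const_mul_atTop (by linarith)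
    · filter_upwards [hev l h1 hlk] with n hn
      exact (p n).T₀_le_of_M₁_lt (q n) hη₀' hn.1 hn.2.1 hn.2.2.1
  have hzero : ∀ l (g : ℕ → ℝ), ∀ n ∉ {n | 0 < (p n).T₀ l}, ((p n).T₀ l : ℝ) * g n = 0 :=
    fun l g n hn => by simp [Nat.eq_zero_of_not_pos hn]
  constructor
  · rw [← Finset.sum_const_zero (s := Finset.Icc 1 k)]
    refine tendsto_finsetSum _ fun l hl => ?_
    obtain ⟨h1, hlk⟩ := Finset.mem_Icc.1 hl
    refine tendsto_zero_of_tendsto_principal (s := {n | 0 < (p n).T₀ l}) ?_ (hzero l _)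
    simp_rw [mul_add]
    rw [← add_zero (0 : ℝ)]
    exact (hQ l h1 hlk).add (tendsto_mul_of_le_exp (hsnr l h1 hlk) (fun n => Nat.cast_nonneg _)
      (hTb l h1 hlk) (fun y hy => Psi_nonneg hη₀.le hy l) (tendsto_exp_mul_Psi hη₀ hb l))
  -- The Q terms are those of the error bound; the Chernoff term takes the place of Ψ, with rate
  -- 3η₀/4 > η₀/2 > b.
  · have hlim : Tendsto (fun n => ∑ l ∈ Finset.Icc 1 k,
        ((p n).T₀ l : ℝ) * (p n).pairBound (q n) η₀ l) atTop (𝓝 0) := by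
      rw [← Finset.sum_const_zero (s := Finset.Icc 1 k)]
      refine tendsto_finsetSum _ fun l hl => ?_
      obtain ⟨h1, hlk⟩ := Finset.mem_Icc.1 hl
      refine tendsto_zero_of_tendsto_principal (s := {n | 0 < (p n).T₀ l}) ?_ (hzero l _)
      simp_rw [Problem.pairBound, mul_add]
      rw [← add_zero (0 : ℝ)]
      have hK : (0 : ℝ) ≤ expSqMoment ^ k :=
        pow_nonneg (zero_le_one.trans one_le_expSqMoment) _
      refine (hQ l h1 hlk).add (tendsto_mul_of_le_exp
        (g := fun y => expSqMoment ^ k * Real.exp (-(3 / 4 * η₀ * y))) (hsnr l h1 hlk)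
        (fun n => Nat.cast_nonneg _) (hTb l h1 hlk)
        (fun y _ => mul_nonneg hK (Real.exp_pos _).le) ?_)
      -- The power 0 leaves the pure exponential.
      have h := (tendsto_rpow_mul_exp_neg_mul_atTop_nhds_zero 0 (3 / 4 * η₀ - b)
        (by linarith)).const_mul (expSqMoment ^ k)
      rw [mul_zero] at h
      refine h.congr fun y => ?_
      rw [Real.rpow_zero, one_mul, mul_left_comm, ← Real.exp_add]
      congr 2
      ring
    refine squeeze_zero' (Eventually.of_forall fun n => (p n).errorProb_nonneg _) ?_ hlim
    have hall : ∀ᶠ n in atTop, ∀ l ∈ Finset.Icc 1 k, 0 < (p n).T₀ l → 0 < (p n).snr (q n) l := by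
      rw [Filter.eventually_all_finset]
      intro l hl
      obtain ⟨h1, hlk⟩ := Finset.mem_Icc.1 hl
      have := hev l h1 hlk
      rw [eventually_inf_principal] at this
      filter_upwards [this] with n hn hpos
      exact (hn hpos).2.1
    filter_upwards [hall] with n hn
    exact (p n).errorProb_le (q n) hη₀ hη₀' (hζ n) hn
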